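/- A polymatroid on a finite set $M$ is a function $f$ from the subsets of $M$ to $\mathbb{R}$ with $f(\emptyset)=0$ that is non-negative, monotone and submodular. Write $IJ$ for $I\cup J$ and $a$ for $\{a\}$, and put $$f(I,J|K)=f(IK)+f(JK)-f(IJK)-f(K),\qquad f(I,J)=f(I,J|\emptyset),\qquad f(I|K)=f(IK)-f(K),$$ $$f[I,J,K,L]=-f(I,J)+f(I,J|K)+f(I,J|L)+f(K,L).$$ Let $a,b,x_1,x_2,y$ be distinct elements, let $f_X$ be a polymatroid on $\{a,b,x_1,x_2\}$ and $f_y$ a polymatroid on $\{a,b,y\}$ with the same restriction to $\{a,b\}$. Then $f_X$ and $f_y$ have an amalgam, that is, there is a polymatroid on $\{a,b,x_1,x_2,y\}$ extending both $f_X$ and $f_y$, if and only if the two inequalities $$f_X[a,b,x_1,x_2]+f_y(y,a|b)+f_y(y,b|a)+f_y(a,b|y)+3f_y(y|ab)\ge 0,$$ $$f_X[a,x_1,b,x_2]+f_y(y,a|b)+f_y(y,b|a)+f_y(a,b|y)+3f_y(y|ab)\ge 0,$$ and all inequalities obtained from them by interchanging $a$ and $b$, or $x_1$ and $x_2$, or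 both, hold. -/

import Mathlib

namespace Polymatroid

/-- `f` is the rank function of a polymatroid with ground set `M`. Only the values of `f` on
subsets of `M` matter; the value at the empty set is zero by convention. -/
structure IsPolymatroid {α : Type*} [DecidableEq α] (f : Finset α → ℝ) (M : Finset α) : Prop where
  empty : f ∅ = 0
  nonneg : ∀ A : Finset α, A ⊆ M → 0 ≤ f A
  mono : ∀ A B : Finset α, A ⊆ B → B ⊆ M → f A ≤ f B
  submodular : ∀ A B : Finset α, A ⊆ M → B ⊆ M → f (A ∪ B) + f (A ∩ B) ≤ f A + f B

/-- `f` and `g` have the same restriction to `M`. -/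
def AgreeOn {α : Type*} (f g : Finset α → ℝ) (M : Finset α) : Prop :=
  ∀ A : Finset α, A ⊆ M → f A = g A

/-- The polymatroids `(f, M)` and `(g, N)` have an amalgam: there is a polymatroid on `M ∪ N`
extending both. -/
def HaveAmalgam {α : Type*} [DecidableEq α] (f : Finset α → ℝ) (M : Finset α)
    (g : Finset α → ℝ) (N : Finset α) : Prop :=
  ∃ h : Finset α → ℝ, IsPolymatroid h (M ∪ N) ∧ AgreeOn h f M ∧ AgreeOn h g N

/-- `f(I,J|K) = f(IK) + f(JK) - f(IJK) - f(K)`. -/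
def condMutualInfo {α : Type*} [DecidableEq α] (f : Finset α → ℝ) (I J K : Finset α) : ℝ :=
  f (I ∪ K) + f (J ∪ K) - f (I ∪ J ∪ K) - f K

/-- `f(I,J) = f(I,J|∅)`. -/
def mutualInfo {α : Type*} [DecidableEq α] (f : Finset α → ℝ) (I J : Finset α) : ℝ :=
  condMutualInfo f I J ∅

/-- `f(I|K) = f(IK) - f(K)`. -/
def condRank {α : Type*} [DecidableEq α] (f : Finset α → ℝ) (I K : Finset α) : ℝ :=
  f (I ∪ K) - f K

/-- The Ingleton expression `f[I,J,K,L] = -f(I,J) + f(I,J|K) + f(I,J|L) + f(K,L)`. -/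
def ingleton {α : Type*} [DecidableEq α] (f : Finset α → ℝ) (I J K L : Finset α) : ℝ :=
  -mutualInfo f I J + condMutualInfo f I J K + condMutualInfo f I J L + mutualInfo f K L

end Polymatroid

namespace Polymatroid

-- Being a polymatroid is a finite system of linear inequalities, the elemental ones: monotonicity
-- just below the whole set, and submodularity for two elements over a common set. Writing p, q for
-- x₁, x₂, an amalgam has all its ranks prescribed except those of the twelve sets that contain y
-- and meet {p, q}. Its existence is thus feasibility of a linear system in twelve unknowns, and the
-- theorem describes the projection of that system.
--
-- The rank of aby cancels in the f_y part, and the remaining rank of ab cancels against the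
-- Ingleton expression. The first inequality is invariant under both interchanges, so the eight
-- conditions reduce to five, `IngletonBounds`.
--
-- Necessity: each bound is a nonnegative combination of elemental inequalities of the amalgam
-- (`ElemExt.ingletonBounds`). Sufficiency: Fourier–Motzkin elimination of the unknowns leaves
-- nothing but these bounds and the inequalities of the given polymatroids (`exists_elemExt_quad`).
-- `IsPolymatroid.exists_elemExt` and `ElemExt.isPolymatroid` translate between set functions and
-- bits.

local notation "𝟬" => false

local notation "𝟭" => true

/-! ### Elemental inequalities in coordinates -/

/-- The elemental inequalities of a polymatroid on four elements `a, b, p, q`, where `f i j k l` is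
the rank of the set whose membership bits at `a, b, p, q` are `i, j, k, l`. -/
structure ElemIneq (f : Bool → Bool → Bool → Bool → ℝ) : Prop where
  ma : f 𝟬 𝟭 𝟭 𝟭 ≤ f 𝟭 𝟭 𝟭 𝟭
  mb : f 𝟭 𝟬 𝟭 𝟭 ≤ f 𝟭 𝟭 𝟭 𝟭
  mp : f 𝟭 𝟭 𝟬 𝟭 ≤ f 𝟭 𝟭 𝟭 𝟭
  mq : f 𝟭 𝟭 𝟭 𝟬 ≤ f 𝟭 𝟭 𝟭 𝟭
  sab : ∀ k l : Bool, f 𝟭 𝟭 k l + f 𝟬 𝟬 k l ≤ f 𝟭 𝟬 k l + f 𝟬 𝟭 k l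
  sap : ∀ j l : Bool, f 𝟭 j 𝟭 l + f 𝟬 j 𝟬 l ≤ f 𝟭 j 𝟬 l + f 𝟬 j 𝟭 l
  saq : ∀ j k : Bool, f 𝟭 j k 𝟭 + f 𝟬 j k 𝟬 ≤ f 𝟭 j k 𝟬 + f 𝟬 j k 𝟭
  sbp : ∀ i l : Bool, f i 𝟭 𝟭 l + f i 𝟬 𝟬 l ≤ f i 𝟭 𝟬 l + f i 𝟬 𝟭 l
  sbq : ∀ i k : Bool, f i 𝟭 k 𝟭 + f i 𝟬 k 𝟬 ≤ f i 𝟭 k 𝟬 + f i 𝟬 k 𝟭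
  spq : ∀ i j : Bool, f i j 𝟭 𝟭 + f i j 𝟬 𝟬 ≤ f i j 𝟭 𝟬 + f i j 𝟬 𝟭

/-- The elemental inequalities of a polymatroid on five elements `a, b, p, q, y`, where `f` and `g`
give the ranks of the sets not containing `y` and of those containing `y`. -/
structure ElemExt (f g : Bool → Bool → Bool → Bool → ℝ) : Prop where
  left : ElemIneq f
  right : ElemIneq g
  top : f 𝟭 𝟭 𝟭 𝟭 ≤ g 𝟭 𝟭 𝟭 𝟭
  anti_a : ∀ j k l : Bool, g 𝟭 j k l + f 𝟬 j k l ≤ f 𝟭 j k l + g 𝟬 j k l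
  anti_b : ∀ i k l : Bool, g i 𝟭 k l + f i 𝟬 k l ≤ f i 𝟭 k l + g i 𝟬 k l
  anti_p : ∀ i j l : Bool, g i j 𝟭 l + f i j 𝟬 l ≤ f i j 𝟭 l + g i j 𝟬 l
  anti_q : ∀ i j k : Bool, g i j k 𝟭 + f i j k 𝟬 ≤ f i j k 𝟭 + g i j k 𝟬

/-- The five Ingleton-type bounds, with `g₀, ga, gb` the ranks of `y`, `ay`, `by`. -/
structure IngletonBounds (f : Bool → Bool → Bool → Bool → ℝ) (g₀ ga gb : ℝ) : Prop where
  ab_pq :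
    2 * f 𝟭 𝟬 𝟬 𝟬 + 2 * f 𝟬 𝟭 𝟬 𝟬 + f 𝟭 𝟭 𝟭 𝟬 + f 𝟭 𝟭 𝟬 𝟭 + f 𝟬 𝟬 𝟭 𝟭 + g₀ ≤
      f 𝟭 𝟬 𝟭 𝟬 + f 𝟬 𝟭 𝟭 𝟬 + f 𝟭 𝟬 𝟬 𝟭 + f 𝟬 𝟭 𝟬 𝟭 + 2 * ga + 2 * gb
  ap_bq :
    2 * f 𝟭 𝟬 𝟬 𝟬 + f 𝟬 𝟭 𝟬 𝟬 + f 𝟬 𝟬 𝟭 𝟬 + f 𝟭 𝟭 𝟭 𝟬 + f 𝟬 𝟭 𝟬 𝟭 + f 𝟭 𝟬 𝟭 𝟭 + g₀ ≤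
      f 𝟭 𝟬 𝟭 𝟬 + f 𝟬 𝟭 𝟭 𝟬 + f 𝟭 𝟬 𝟬 𝟭 + f 𝟬 𝟬 𝟭 𝟭 + 2 * ga + 2 * gb
  aq_bp :
    2 * f 𝟭 𝟬 𝟬 𝟬 + f 𝟬 𝟭 𝟬 𝟬 + f 𝟬 𝟭 𝟭 𝟬 + f 𝟬 𝟬 𝟬 𝟭 + f 𝟭 𝟭 𝟬 𝟭 + f 𝟭 𝟬 𝟭 𝟭 + g₀ ≤
      f 𝟭 𝟬 𝟭 𝟬 + f 𝟭 𝟬 𝟬 𝟭 + f 𝟬 𝟭 𝟬 𝟭 + f 𝟬 𝟬 𝟭 𝟭 + 2 * ga + 2 * gb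
  bp_aq :
    f 𝟭 𝟬 𝟬 𝟬 + 2 * f 𝟬 𝟭 𝟬 𝟬 + f 𝟬 𝟬 𝟭 𝟬 + f 𝟭 𝟭 𝟭 𝟬 + f 𝟭 𝟬 𝟬 𝟭 + f 𝟬 𝟭 𝟭 𝟭 + g₀ ≤
      f 𝟭 𝟬 𝟭 𝟬 + f 𝟬 𝟭 𝟭 𝟬 + f 𝟬 𝟭 𝟬 𝟭 + f 𝟬 𝟬 𝟭 𝟭 + 2 * ga + 2 * gb
  bq_ap :
    f 𝟭 𝟬 𝟬 𝟬 + 2 * f 𝟬 𝟭 𝟬 𝟬 + f 𝟭 𝟬 𝟭 𝟬 + f 𝟬 𝟬 𝟬 𝟭 + f 𝟭 𝟭 𝟬 𝟭 + f 𝟬 𝟭 𝟭 𝟭 + g₀ ≤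
      f 𝟬 𝟭 𝟭 𝟬 + f 𝟭 𝟬 𝟬 𝟭 + f 𝟬 𝟭 𝟬 𝟭 + f 𝟬 𝟬 𝟭 𝟭 + 2 * ga + 2 * gb

/-- The function on `Bool⁴` with the given values, listed by the number of `true` arguments. -/
def quad (c0 ca cb cp cq cab cap caq cbp cbq cpq cabp cabq capq cbpq cabpq : ℝ) :
    Bool → Bool → Bool → Bool → ℝ
  | false, false, false, false => c0
  | true, false, false, false => ca
  | false, true, false, false => cb
  | false, false, true, false => cp
  | false, false, false, true => cq
  | true, true, false, false => cab
  | true, false, true, false => cap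
  | true, false, false, true => caq
  | false, true, true, false => cbp
  | false, true, false, true => cbq
  | false, false, true, true => cpq
  | true, true, true, false => cabp
  | true, true, false, true => cabq
  | true, false, true, true => capq
  | false, true, true, true => cbpq
  | true, true, true, true => cabpq

/-! ### Sufficiency: elimination of the unknown ranks -/

/-- Real numbers bounded below by `L` and above by `U` exist if every element of `L` is at most every
element of `U`. -/
theorem exists_between_lists (L U : List ℝ) (h : L.Forall fun l => U.Forall fun u => l ≤ u) :
    ∃ v, (L.Forall fun l => l ≤ v) ∧ U.Forall fun u => v ≤ u := by
  simp only [List.forall_iff_forall_mem] at *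
  induction L with
  | nil =>
    obtain ⟨v, hv⟩ := (List.finite_toSet U).bddBelow
    exact ⟨v, by simp, fun u hu => hv hu⟩
  | cons l L ih =>
    obtain ⟨v, hL, hU⟩ := ih fun x hx => h x (List.mem_cons_of_mem _ hx)
    refine ⟨max l v, ?_, fun u hu => max_le (h l List.mem_cons_self u hu) (hU u hu)⟩
    exact List.forall_mem_cons.2 ⟨le_max_left _ _, fun x hx => (hL x hx).trans (le_max_right _ _)⟩

set_option maxHeartbeats 4000000 in
/-- A polymatroid on `a, b, p, q` that satisfies the five Ingleton-type bounds extends along a fifth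
element `y` with prescribed ranks of `y`, `ay`, `by` and `aby`. The unknown ranks are found by
eliminating them one after the other. -/
theorem exists_elemExt_quad
    {fa fb fp fq fab fap faq fbp fbq fpq fabp fabq fapq fbpq fabpq
      g₀ ga gb gab : ℝ}
    (hf : ElemIneq (quad 0 fa fb fp fq fab fap faq fbp fbq fpq fabp fabq fapq fbpq fabpq))
    (y₀ : fab ≤ gab)
    (ya : gb ≤ gab)
    (yb : ga ≤ gab)
    (da : ga ≤ fa + g₀)
    (db : gb ≤ fb + g₀)
    (dab : fa + gab ≤ fab + ga)
    (dba : fb + gab ≤ fab + gb)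
    (sy : g₀ + gab ≤ ga + gb)
    (hc : IngletonBounds
      (quad 0 fa fb fp fq fab fap faq fbp fbq fpq fabp fabq fapq fbpq fabpq) g₀ ga gb) :
    ∃ gp gq gap gaq gbp gbq gpq gabp gabq gapq gbpq gabpq : ℝ,
      ElemExt (quad 0 fa fb fp fq fab fap faq fbp fbq fpq fabp fabq fapq fbpq fabpq)
        (quad g₀ ga gb gp gq gab gap gaq gbp gbq gpq gabp gabq gapq gbpq gabpq) := by
  have ma := hf.ma
  have mb := hf.mb
  have mp := hf.mp
  have mq := hf.mq
  have sab := hf.sab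
  have sap := hf.sap
  have saq := hf.saq
  have sbp := hf.sbp
  have sbq := hf.sbq
  have spq := hf.spq
  obtain ⟨c1, c2, c3, c4, c5⟩ := hc
  simp only [Bool.forall_bool, quad] at ma mb mp mq sab sap saq sbp sbq spq c1 c2 c3 c4 c5
  obtain ⟨⟨sab, sab_q⟩, sab_p, sab_pq⟩ := sab
  obtain ⟨⟨sap, sap_q⟩, sap_b, sap_bq⟩ := sap
  obtain ⟨⟨saq, saq_p⟩, saq_b, saq_bp⟩ := saq
  obtain ⟨⟨sbp, sbp_q⟩, sbp_a, sbp_aq⟩ := sbp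
  obtain ⟨⟨sbq, sbq_p⟩, sbq_a, sbq_ap⟩ := sbq
  obtain ⟨⟨spq, spq_b⟩, spq_a, spq_ab⟩ := spq
  -- The bounds on the unknown chosen last, `gbp`, are elemental inequalities; earlier lists also
  -- carry the consequences of eliminating the unknowns chosen after them. Here the entries with
  -- denominator 3 say that 3 (`gabpq` - `fabpq`) is at most the slack of each Ingleton-type bound,
  -- so against `fabpq` they are exactly `c1` to `c5`. The second lower bound is submodularity of p,
  -- q over aby for the values of `gabp` and `gabq` used at the end.
  obtain ⟨gabpq, h⟩ := exists_between_lists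
    [fabpq, 2 * fabpq + gab - fabp - fabq]
    [fabpq + gab - fab,
      (fap + fbp + faq + fbq + 3 * fabpq + 2 * ga + 2 * gb - 2 * fa - 2 * fb - fabp - fabq - fpq -
        g₀) / 3,
      (fap + fbp + fbq + fpq + 3 * fabpq + 2 * ga + 2 * gb - fa - 2 * fb - fp - fabp - faq - fbpq
        - g₀) / 3,
      (fap + fbp + faq + fpq + 3 * fabpq + 2 * ga + 2 * gb - 2 * fa - fb - fp - fabp - fbq - fapq
        - g₀) / 3,
      (fap + faq + fbq + fpq + 3 * fabpq + 2 * ga + 2 * gb - 2 * fa - fb - fbp - fq - fabq - fapq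
        - g₀) / 3,
      (fbp + faq + fbq + fpq + 3 * fabpq + 2 * ga + 2 * gb - fa - 2 * fb - fap - fq - fabq - fbpq
        - g₀) / 3]
    (by
      simp only [List.Forall]
      and_intros <;>
        linarith only [sab_pq, sap_q, sap_bq, saq_p, saq_bp, sbp_q, sbp_aq, sbq_p, sbq_ap, spq_a,
        spq_b, spq_ab, y₀, dab, dba, sy, c1, c2, c3, c4, c5])
  simp only [List.Forall] at h
  obtain ⟨⟨labpq_1, labpq_2⟩, uabpq_1, uabpq_2, uabpq_3, uabpq_4, uabpq_5, uabpq_6⟩ := h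
  obtain ⟨gapq, h⟩ := exists_between_lists
    [fapq + gabpq - fabpq, ga + gabpq - gab]
    [gabpq,
      fapq + ga - fa,
      fap + faq + fbq + fpq + 2 * fabpq + 2 * ga + 2 * gb - 2 * fa - fb - fbp - fq - fabq - g₀ - 2
        * gabpq,
      fap + fbp + faq + fpq + 2 * fabpq + 2 * ga + 2 * gb - 2 * fa - fb - fp - fabp - fbq - g₀ - 2
        * gabpq,
      fap + fbp + faq + fbq + fapq + 2 * fabpq + 2 * ga + 2 * gb - 2 * fa - 2 * fb - fabp - fabq -
        fpq - g₀ - 2 * gabpq,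
      fap + fbp + fbq + fpq + fapq + 2 * fabpq + 2 * ga + 2 * gb - fa - 2 * fb - fp - fabp - faq -
        fbpq - g₀ - 2 * gabpq,
      fbp + faq + fbq + fpq + fapq + 2 * fabpq + 2 * ga + 2 * gb - fa - 2 * fb - fap - fq - fabq -
        fbpq - g₀ - 2 * gabpq]
    (by
      simp only [List.Forall]
      and_intros <;>
        linarith only [mb, sab_pq, sap_b, sap_bq, saq_b, saq_bp, sbp_a, sbp_q, sbp_aq, sbq_a,
        sbq_p, sbq_ap, spq_b, yb, dab, dba, sy, uabpq_1, uabpq_2, uabpq_3, uabpq_4, uabpq_5,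
        uabpq_6])
  simp only [List.Forall] at h
  obtain ⟨⟨lapq_1, lapq_2⟩, uapq_1, uapq_2, uapq_3, uapq_4, uapq_5, uapq_6, uapq_7⟩ := h
  obtain ⟨gaq, h⟩ := exists_between_lists
    [faq + gapq - fapq,
      fabq + ga + gabpq - fabpq - gab,
      fa + fb + fbp + fq + fabq + g₀ + gapq + 2 * gabpq - fap - fbq - fpq - 2 * fabpq - ga - 2 *
        gb,
      fa + fb + fp + fabp + fbq + g₀ + gapq + 2 * gabpq - fap - fbp - fpq - 2 * fabpq - ga - 2 *
        gb,
      (2 * fb + fp + fq + fabq + fbpq + ga + gapq + 2 * gabpq - fap - fbp - fbq - fpq - 2 * fabpq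
        - 2 * gb) / 2,
      fa + 2 * fb + fabp + fabq + fpq + g₀ + gapq + 2 * gabpq - fap - fbp - fbq - fapq - 2 * fabpq
        - ga - 2 * gb,
      2 * fb + fap + fq + fabq + fbpq + g₀ + gapq + 2 * gabpq - fbp - fbq - fpq - fapq - 2 * fabpq
        - ga - 2 * gb]
    [fabq + gapq - fabpq,
      faq + ga - fa,
      fap + fbp + fbq + fpq + 2 * fabpq + 2 * ga + 2 * gb - fa - 2 * fb - fp - fabp - fbpq - g₀ -
        2 * gabpq]
    (by
      simp only [List.Forall]
      and_intros <;>
        linarith only [sab_p, sab_q, sab_pq, sap_b, sap_bq, saq_b, saq_p, saq_bp, sbp_a, sbp_q,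
        sbp_aq, sbq_a, sbq_p, sbq_ap, spq_a, spq_b, dba, sy, labpq_2, uabpq_1, lapq_2, uapq_2,
        uapq_3, uapq_4, uapq_5, uapq_6, uapq_7])
  simp only [List.Forall] at h
  obtain ⟨⟨laq_1, laq_2, laq_3, laq_4, laq_5, laq_6, laq_7⟩, uaq_1, uaq_2, uaq_3⟩ := h
  obtain ⟨gap, h⟩ := exists_between_lists
    [fap + gapq - fapq,
      ga + gapq - gaq,
      fabp + ga + gabpq - fabpq - gab,
      fb + fbp + fq + fabq + g₀ + gapq + 2 * gabpq - fbq - fpq - 2 * fabpq - 2 * gb - gaq,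
      fb + fp + fabp + fbq + g₀ + gapq + 2 * gabpq - fbp - fpq - 2 * fabpq - 2 * gb - gaq,
      2 * fb + fp + fabp + fbpq + g₀ + gaq + 2 * gabpq - fbp - fbq - fpq - 2 * fabpq - ga - 2 *
        gb,
      2 * fb + fp + fabp + fq + fbpq + gaq + 2 * gabpq - fbp - faq - fbq - fpq - 2 * fabpq - 2 *
        gb,
      2 * fb + fabp + fabq + fpq + g₀ + gapq + 2 * gabpq - fbp - fbq - fapq - 2 * fabpq - 2 * gb -
        gaq]
    [fap + ga - fa,
      fabp + gapq - fabpq,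
      fbp + fbq + fpq + 2 * fabpq + ga + 2 * gb + gaq - 2 * fb - fq - fabq - fbpq - g₀ - 2 *
        gabpq,
      fap + fbp + fbq + fpq + 2 * fabpq + 2 * gb + gaq - 2 * fb - fp - fq - fabq - fbpq - 2 *
        gabpq]
    (by
      simp only [List.Forall]
      and_intros <;>
        linarith only [sab_p, sab_q, sab_pq, sap_b, sap_q, sap_bq, saq_b, saq_p, saq_bp, sbp_a,
        sbp_q, sbq_p, sbq_ap, spq_a, spq_b, dba, sy, labpq_2, uabpq_1, laq_1, laq_2, laq_3, laq_4,
        laq_5, laq_6, laq_7, uaq_1, uaq_2, uaq_3])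
  simp only [List.Forall] at h
  obtain ⟨⟨lap_1, lap_2, lap_3, lap_4, lap_5, lap_6, lap_7, lap_8⟩, uap_1, uap_2, uap_3, uap_4⟩ :=
  h
  obtain ⟨gbq, h⟩ := exists_between_lists
    [fbq + gabpq - fabpq,
      fabq + gb + gabpq - fabpq - gab,
      fbp + fq + fabq + g₀ + gapq + 2 * gabpq - fpq - 2 * fabpq - gb - gap - gaq,
      fb + fabp + fabq + fpq + g₀ + gapq + 2 * gabpq - fbp - fapq - 2 * fabpq - gb - gap - gaq,
      (fp + fq + fabq + fbpq + gb + gapq + 2 * gabpq - fbp - fpq - 2 * fabpq - gap - gaq) / 2,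
      fb + fq + fabq + fbpq + g₀ + gap + 2 * gabpq - fbp - fpq - 2 * fabpq - ga - gb - gaq,
      fb + fp + fq + fabq + fbpq + gap + 2 * gabpq - fap - fbp - fpq - 2 * fabpq - gb - gaq,
      fb + fp + fabp + fq + fbpq + gaq + 2 * gabpq - fbp - faq - fpq - 2 * fabpq - gb - gap,
      fb + fp + fabp + fbpq + g₀ + gaq + 2 * gabpq - fbp - fpq - 2 * fabpq - ga - gb - gap]
    [fabq + gabpq - fabpq,
      fbq + gb - fb,
      fbp + fpq + fabpq + 2 * gb + gap + gaq - fb - fp - fabp - g₀ - gapq - gabpq]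
    (by
      simp only [List.Forall]
      and_intros <;>
        linarith only [ma, sab_p, sab_q, sab_pq, sap_b, sap_q, sap_bq, saq_b, saq_p, saq_bp,
        sbq_p, spq_b, ya, dba, sy, labpq_2, uabpq_1, lapq_1, laq_1, laq_2, uaq_1, lap_1, lap_2,
        lap_3, lap_4, lap_5, lap_6, lap_7, lap_8, uap_2, uap_3, uap_4])
  simp only [List.Forall] at h
  obtain ⟨⟨lbq_1, lbq_2, lbq_3, lbq_4, lbq_5, lbq_6, lbq_7, lbq_8, lbq_9⟩, ubq_1, ubq_2, ubq_3⟩ :=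
  h
  obtain ⟨gbpq, h⟩ := exists_between_lists
    [fbpq + gabpq - fabpq, fabpq + gbq - fabq]
    [gabpq,
      fbpq + gbq - fbq,
      fbp + fpq + fabpq + ga + gb + gaq + gbq - fb - fq - fabq - g₀ - gap - gabpq,
      fbp + faq + fpq + fabpq + gb + gap + gbq - fb - fp - fabp - fq - gaq - gabpq,
      fbp + fpq + fabpq + gap + gaq + 2 * gbq - fp - fq - fabq - gb - gapq - gabpq,
      fap + fbp + fpq + fabpq + gb + gaq + gbq - fb - fp - fq - fabq - gap - gabpq,
      fpq + fbpq + fabpq + gb + gap + gaq + gbq - fbp - fq - fabq - g₀ - gapq - gabpq,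
      fbp + fpq + fabpq + ga + gb + gap + gbq - fb - fp - fabp - g₀ - gaq - gabpq,
      fbp + fbpq + 2 * fabpq + gb + gap + gaq + gbq - fb - fabp - fabq - fpq - g₀ - 2 * gabpq]
    (by
      simp only [List.Forall]
      and_intros <;>
        linarith only [ma, sab_p, sab_pq, sap_b, sap_q, sap_bq, saq_p, saq_bp, sy, labpq_2,
        uabpq_1, lapq_1, laq_1, uaq_1, lap_1, lap_2, lap_3, uap_2, lbq_1, lbq_2, lbq_3, lbq_4,
        lbq_5, lbq_6, lbq_7, lbq_8, lbq_9, ubq_1, ubq_2])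
  simp only [List.Forall] at h
  obtain ⟨⟨lbpq_1, lbpq_2⟩, ubpq_1, ubpq_2, ubpq_3, ubpq_4, ubpq_5, ubpq_6, ubpq_7, ubpq_8,
  ubpq_9⟩ := h
  obtain ⟨gq, h⟩ := exists_between_lists
    [g₀ + gaq - ga,
      g₀ + gbq - gb,
      fq + gaq - faq,
      fq + gbq - fbq,
      fbp + fq + g₀ + gapq + gbpq - fpq - fbpq - gb - gap,
      fp + fq + gb + gapq + gbpq - fbp - fpq - gap - gbq,
      fb + fp + fq + gap + gbpq - fap - fbp - fpq - gb,
      fb + fq + g₀ + gap + gbpq - fbp - fpq - ga - gb,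
      fb + fabp + fpq + g₀ + gapq + gabpq - fbp - fapq - fabpq - gb - gap,
      fp + fabp + fq + gb + gapq + gabpq - fbp - fpq - fabpq - gab - gap,
      fb + fabp + fpq + g₀ + gbpq + gabpq - fbp - fbpq - fabpq - gb - gap]
    [fq + g₀,
      fabpq + gaq + gbq - fabq - gabpq,
      fbp + fpq + fabpq + gb + gap + gbq - fb - fp - fabp - gbpq - gabpq,
      fbp + fpq + fabpq + gb + gap + gaq - fb - fp - fabp - gapq - gabpq]
    (by
      simp only [List.Forall]
      and_intros <;>
        linarith only [sab_p, sab_q, sap, sap_b, sap_q, saq, saq_p, sbp, sbp_q, sbq, sbq_p, spq,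
        spq_b, da, db, sy, uabpq_1, lapq_1, laq_1, laq_2, uaq_2, lap_1, lap_2, lap_3, uap_1,
        lbq_2, lbq_4, ubq_2, ubq_3, lbpq_1, ubpq_2, ubpq_3, ubpq_4, ubpq_5, ubpq_6, ubpq_7,
        ubpq_8, ubpq_9])
  simp only [List.Forall] at h
  obtain ⟨⟨lq_1, lq_2, lq_3, lq_4, lq_5, lq_6, lq_7, lq_8, lq_9, lq_10, lq_11⟩, uq_1, uq_2, uq_3,
  uq_4⟩ := h
  obtain ⟨gpq, h⟩ := exists_between_lists
    [fpq + gbpq - fbpq,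
      fpq + gapq - fapq,
      gq + gapq - gaq,
      gq + gbpq - gbq,
      fb + fp + gap + gbpq - fap - fbp - gb,
      fb + g₀ + gap + gbpq - fbp - ga - gb,
      fp + gb + gapq + gbpq - fbp - gap - gbq,
      fbp + g₀ + gapq + gbpq - fbpq - gb - gap,
      fp + fabp + gb + gapq + gabpq - fbp - fabpq - gab - gap]
    [fpq + gq - fq,
      gapq + gbpq - gabpq,
      fbp + fpq + fabpq + gb + gap - fb - fp - fabp - gabpq,
      fbp + fabpq + gb + gap + gq - fb - fabp - g₀ - gabpq]
    (by
      simp only [List.Forall]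
      and_intros <;>
        linarith only [sab_p, sab_pq, sap_b, sap_q, saq_p, saq_bp, sbp_q, sbq_p, spq_b, sy,
        labpq_2, uabpq_1, lapq_1, laq_1, uaq_1, lap_1, lap_2, lap_3, uap_2, lbq_2, ubq_2, lbpq_1,
        lbpq_2, ubpq_2, lq_1, lq_2, lq_3, lq_4, lq_5, lq_6, lq_7, lq_8, lq_9, lq_10, lq_11, uq_2,
        uq_3, uq_4])
  simp only [List.Forall] at h
  obtain ⟨⟨lpq_1, lpq_2, lpq_3, lpq_4, lpq_5, lpq_6, lpq_7, lpq_8, lpq_9⟩, upq_1, upq_2, upq_3,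
  upq_4⟩ := h
  obtain ⟨gp, h⟩ := exists_between_lists
    [fp + gap - fap,
      fp + gpq - fpq,
      g₀ + gpq - gq,
      g₀ + gap - ga,
      fp + gb + gbpq - fbp - gbq,
      fbp + g₀ + gbpq - fbpq - gb,
      fp + fabp + gb + gabpq - fbp - fabpq - gab]
    [fp + g₀,
      gap + gpq - gapq,
      fbp + gb + gpq - fb - gbpq,
      fbp + fabpq + gb + gap - fb - fabp - gabpq]
    (by
      simp only [List.Forall]
      and_intros <;>
        linarith only [sab_p, sap, sap_b, saq_p, sbp, sbq_p, spq, spq_b, da, db, sy, uabpq_1,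
        lapq_1, lap_1, lap_2, lap_3, uap_1, ubq_2, lbpq_1, ubpq_2, lq_1, lq_2, uq_1, lpq_1, lpq_2,
        lpq_3, lpq_4, lpq_5, lpq_6, lpq_7, lpq_8, lpq_9, upq_1, upq_3, upq_4])
  simp only [List.Forall] at h
  obtain ⟨⟨lp_1, lp_2, lp_3, lp_4, lp_5, lp_6, lp_7⟩, up_1, up_2, up_3, up_4⟩ := h
  obtain ⟨gbp, h⟩ := exists_between_lists
    [gp + gbpq - gpq,
      gb + gbpq - gbq,
      fbp + gbpq - fbpq,
      fabp + gp + gabpq - fabpq - gap,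
      fabp + gb + gabpq - fabpq - gab]
    [fabp + gbpq - fabpq, fbp + gb - fb, fbp + gp - fp, gb + gp - g₀]
    (by
      simp only [List.Forall]
      and_intros <;>
        linarith only [sab_p, sap_b, saq_bp, sbq_p, spq_b, sy, labpq_2, uabpq_1, lapq_1, lap_1,
        lap_3, uap_2, lbq_2, ubq_2, lbpq_2, ubpq_2, lq_2, lpq_1, lpq_4, upq_2, lp_2, lp_3, lp_4,
        lp_5, lp_6, lp_7, up_2, up_3, up_4])
  simp only [List.Forall] at h
  obtain ⟨⟨lbp_1, lbp_2, lbp_3, lbp_4, lbp_5⟩, ubp_1, ubp_2, ubp_3, ubp_4⟩ := h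
  -- The ranks of abpy and abqy take the least values allowed by `anti_q` and `anti_p`, so they need
  -- no elimination.
  refine ⟨gp, gq, gap, gaq, gbp, gbq, gpq, (gabpq + fabp - fabpq), (gabpq + fabq - fabpq), gapq,
  gbpq, gabpq, hf, ?_, ?_, ?_, ?_, ?_, ?_⟩
  · constructor
    · simp only [quad]
      linarith only [ubpq_1]
    · simp only [quad]
      linarith only [uapq_1]
    · simp only [quad]
      linarith only [mp]
    · simp only [quad]
      linarith only [mq]
    · rintro (_ | _) (_ | _) <;> simp only [quad] <;>
        linarith only [sy, uq_2, upq_2, lbp_4]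
    · rintro (_ | _) (_ | _) <;> simp only [quad] <;>
        linarith only [lbpq_2, lpq_3, lp_4, lbp_5]
    · rintro (_ | _) (_ | _) <;> simp only [quad] <;>
        linarith only [lbq_2, lq_1, up_2, ubp_1]
    · rintro (_ | _) (_ | _) <;> simp only [quad] <;>
        linarith only [uaq_1, lap_3, lpq_4, ubp_4]
    · rintro (_ | _) (_ | _) <;> simp only [quad] <;>
        linarith only [laq_2, uap_2, lq_2, lbp_1]
    · rintro (_ | _) (_ | _) <;> simp only [quad] <;>
        linarith only [labpq_2, lap_2, lp_3, lbp_2]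
  · simp only [quad]
    linarith only [labpq_1]
  · rintro (_ | _) (_ | _) (_ | _) <;> simp only [quad] <;>
      linarith only [da, dba, lbpq_1, ubpq_2, lq_3, lpq_2, lp_1, lbp_3]
  · rintro (_ | _) (_ | _) (_ | _) <;> simp only [quad] <;>
      linarith only [db, dab, lapq_1, laq_1, lap_1, lq_4, lpq_1, ubp_3]
  · rintro (_ | _) (_ | _) (_ | _) <;> simp only [quad] <;>
      linarith only [uabpq_1, laq_1, uap_1, ubpq_2, upq_1, up_1, ubp_2]
  · rintro (_ | _) (_ | _) (_ | _) <;> simp only [quad] <;>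
      linarith only [uabpq_1, uaq_2, lap_1, ubq_2, uq_1, lp_2, lbp_3]

theorem eq_quad {f : Bool → Bool → Bool → Bool → ℝ} :
    f = quad (f 𝟬 𝟬 𝟬 𝟬) (f 𝟭 𝟬 𝟬 𝟬) (f 𝟬 𝟭 𝟬 𝟬) (f 𝟬 𝟬 𝟭 𝟬) (f 𝟬 𝟬 𝟬 𝟭) (f 𝟭 𝟭 𝟬 𝟬)
      (f 𝟭 𝟬 𝟭 𝟬) (f 𝟭 𝟬 𝟬 𝟭) (f 𝟬 𝟭 𝟭 𝟬) (f 𝟬 𝟭 𝟬 𝟭) (f 𝟬 𝟬 𝟭 𝟭) (f 𝟭 𝟭 𝟭 𝟬) (f 𝟭 𝟭 𝟬 𝟭)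
      (f 𝟭 𝟬 𝟭 𝟭) (f 𝟬 𝟭 𝟭 𝟭) (f 𝟭 𝟭 𝟭 𝟭) := by
  funext i j k l
  cases i <;> cases j <;> cases k <;> cases l <;> rfl

theorem exists_elemExt {f f' g' : Bool → Bool → Bool → Bool → ℝ} (hf : ElemIneq f)
    (f₀ : f 𝟬 𝟬 𝟬 𝟬 = 0) (hy : ElemExt f' g') (f₀' : f' 𝟬 𝟬 𝟬 𝟬 = 0)
    (ha : f 𝟭 𝟬 𝟬 𝟬 = f' 𝟭 𝟬 𝟬 𝟬) (hb : f 𝟬 𝟭 𝟬 𝟬 = f' 𝟬 𝟭 𝟬 𝟬)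
    (hab : f 𝟭 𝟭 𝟬 𝟬 = f' 𝟭 𝟭 𝟬 𝟬)
    (hc : IngletonBounds f (g' 𝟬 𝟬 𝟬 𝟬) (g' 𝟭 𝟬 𝟬 𝟬) (g' 𝟬 𝟭 𝟬 𝟬)) :
    ∃ g, ElemExt f g ∧ ∀ i j, g i j 𝟬 𝟬 = g' i j 𝟬 𝟬 := by
  have hq := eq_quad (f := f)
  rw [f₀] at hq
  rw [hq] at hf hc ⊢
  obtain ⟨gp, gq, gap, gaq, gbp, gbq, gpq, gabp, gabq, gapq, gbpq, gabpq, h⟩ :=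
    exists_elemExt_quad hf (gab := g' 𝟭 𝟭 𝟬 𝟬)
      -- Monotonicity is elemental only at the top; submodularity carries it down to subsets of aby.
      (by linarith only [hy.anti_p 𝟭 𝟭 𝟭, hy.anti_q 𝟭 𝟭 𝟬, hy.top, hab])
      (by linarith only [hy.right.sap 𝟭 𝟭, hy.right.saq 𝟭 𝟬, hy.right.ma])
      (by linarith only [hy.right.sbp 𝟭 𝟭, hy.right.sbq 𝟭 𝟬, hy.right.mb])
      (by linarith only [hy.anti_a 𝟬 𝟬 𝟬, ha, f₀'])
      (by linarith only [hy.anti_b 𝟬 𝟬 𝟬, hb, f₀'])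
      (by linarith only [hy.anti_b 𝟭 𝟬 𝟬, ha, hab])
      (by linarith only [hy.anti_a 𝟭 𝟬 𝟬, hb, hab])
      (by linarith only [hy.right.sab 𝟬 𝟬]) hc
  exact ⟨_, h, by rintro (_ | _) (_ | _) <;> rfl⟩

/-! ### Necessity of the bounds -/

/-- The three `h.right` terms are the positive terms of the Ingleton expression conditioned on y,
where -(a,p) + (a,p|b) is first rewritten as -(a,b) + (a,b|p), and similarly for the other bounds.
The `anti` terms and `top` account for adding y to the sets involved. -/
theorem ElemExt.ingletonBounds {f g : Bool → Bool → Bool → Bool → ℝ} (h : ElemExt f g) :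
    IngletonBounds f (g 𝟬 𝟬 𝟬 𝟬) (g 𝟭 𝟬 𝟬 𝟬) (g 𝟬 𝟭 𝟬 𝟬) where
  ab_pq := by
    linarith only [h.right.sab 𝟭 𝟬, h.right.sab 𝟬 𝟭, h.right.spq 𝟬 𝟬, h.anti_a 𝟭 𝟭 𝟭,
      h.anti_b 𝟬 𝟭 𝟭, h.anti_p 𝟭 𝟬 𝟬, h.anti_p 𝟬 𝟭 𝟬, h.anti_p 𝟭 𝟭 𝟭, h.anti_q 𝟭 𝟬 𝟬,
      h.anti_q 𝟬 𝟭 𝟬, h.anti_q 𝟭 𝟭 𝟭, h.top]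
  ap_bq := by
    linarith only [h.right.sab 𝟭 𝟬, h.right.sap 𝟬 𝟭, h.right.sbq 𝟬 𝟬, h.anti_a 𝟭 𝟭 𝟭,
      h.anti_b 𝟭 𝟭 𝟭, h.anti_p 𝟭 𝟬 𝟬, h.anti_p 𝟬 𝟭 𝟬, h.anti_p 𝟬 𝟭 𝟭, h.anti_q 𝟭 𝟬 𝟬,
      h.anti_q 𝟬 𝟬 𝟭, h.anti_q 𝟭 𝟭 𝟭, h.top]
  aq_bp := by
    linarith only [h.right.sab 𝟬 𝟭, h.right.saq 𝟬 𝟭, h.right.sbp 𝟬 𝟬, h.anti_a 𝟭 𝟭 𝟭,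
      h.anti_b 𝟭 𝟭 𝟭, h.anti_p 𝟭 𝟬 𝟬, h.anti_p 𝟬 𝟬 𝟭, h.anti_p 𝟭 𝟭 𝟭, h.anti_q 𝟭 𝟬 𝟬,
      h.anti_q 𝟬 𝟭 𝟬, h.anti_q 𝟬 𝟭 𝟭, h.top]
  bp_aq := by
    linarith only [h.right.sab 𝟭 𝟬, h.right.saq 𝟬 𝟬, h.right.sbp 𝟬 𝟭, h.anti_a 𝟭 𝟭 𝟭,
      h.anti_b 𝟭 𝟭 𝟭, h.anti_p 𝟭 𝟬 𝟬, h.anti_p 𝟬 𝟭 𝟬, h.anti_p 𝟭 𝟬 𝟭, h.anti_q 𝟬 𝟭 𝟬,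
      h.anti_q 𝟬 𝟬 𝟭, h.anti_q 𝟭 𝟭 𝟭, h.top]
  bq_ap := by
    linarith only [h.right.sab 𝟬 𝟭, h.right.sap 𝟬 𝟬, h.right.sbq 𝟬 𝟭, h.anti_a 𝟭 𝟭 𝟭,
      h.anti_b 𝟭 𝟭 𝟭, h.anti_p 𝟬 𝟭 𝟬, h.anti_p 𝟬 𝟬 𝟭, h.anti_p 𝟭 𝟭 𝟭, h.anti_q 𝟭 𝟬 𝟬,
      h.anti_q 𝟬 𝟭 𝟬, h.anti_q 𝟭 𝟬 𝟭, h.top]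

theorem forall_swap_iff {α : Type*} {P : α → α → α → α → Prop} {a b p q : α} :
    (∀ a' b' p' q' : α, (a' = a ∧ b' = b ∨ a' = b ∧ b' = a) →
      (p' = p ∧ q' = q ∨ p' = q ∧ q' = p) → P a' b' p' q') ↔
      (P a b p q ∧ P a b q p) ∧ P b a p q ∧ P b a q p := by
  constructor
  · intro h
    refine ⟨⟨h _ _ _ _ ?_ ?_, h _ _ _ _ ?_ ?_⟩, h _ _ _ _ ?_ ?_, h _ _ _ _ ?_ ?_⟩ <;> simp
  · rintro ⟨⟨h₁, h₂⟩, h₃, h₄⟩ _ _ _ _ (⟨rfl, rfl⟩ | ⟨rfl, rfl⟩) (⟨rfl, rfl⟩ | ⟨rfl, rfl⟩) <;>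
      assumption

/-! ### Set functions and their coordinates -/

variable {α : Type*} [DecidableEq α]

/-- A function that is increasing at the top and submodular on pairs of single-element extensions
is a polymatroid. -/
theorem IsPolymatroid.of_elemental {f : Finset α → ℝ} {M : Finset α} (h₀ : f ∅ = 0)
    (hmono : ∀ i ∈ M, f (M.erase i) ≤ f M)
    (hsub : ∀ i ∈ M, ∀ j ∈ M, i ≠ j → ∀ K ⊆ M, i ∉ K → j ∉ K →
      f (insert i (insert j K)) + f K ≤ f (insert i K) + f (insert j K)) :
    IsPolymatroid f M := by
  have step : ∀ i ∈ M, ∀ K T : Finset α, K ∪ T ⊆ M → i ∉ K ∪ T →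
      f (insert i (K ∪ T)) + f K ≤ f (insert i K) + f (K ∪ T) := by
    intro i hi K T
    induction T using Finset.induction_on with
    | empty => simp
    | insert j T _ ih =>
      rw [Finset.union_insert]
      intro hL hiL
      have hLM := (Finset.subset_insert j (K ∪ T)).trans hL
      have hiL' : i ∉ K ∪ T := fun h => hiL (Finset.mem_insert_of_mem h)
      by_cases hj : j ∈ K ∪ T
      · rw [Finset.insert_eq_of_mem hj]
        exact ih hLM hiL'
      · have h₁ := hsub i hi j (hL (Finset.mem_insert_self j _))
          (fun h => hiL (h ▸ Finset.mem_insert_self i _)) _ hLM hiL' hj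
        have h₂ := ih hLM hiL'
        linarith
  have step' : ∀ i ∈ M, ∀ K L : Finset α, K ⊆ L → L ⊆ M → i ∉ L →
      f (insert i L) + f K ≤ f (insert i K) + f L := by
    intro i hi K L hKL hL hiL
    simpa [Finset.union_eq_right.2 hKL] using step i hi K L
      (by rwa [Finset.union_eq_right.2 hKL]) (by rwa [Finset.union_eq_right.2 hKL])
  have mono : ∀ A T : Finset α, A ∪ T ⊆ M → f A ≤ f (A ∪ T) := by
    intro A T
    induction T using Finset.induction_on with
    | empty => simp
    | insert j T _ ih =>
      rw [Finset.union_insert]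
      intro hL
      have hLM := (Finset.subset_insert j (A ∪ T)).trans hL
      by_cases hj : j ∈ A ∪ T
      · rw [Finset.insert_eq_of_mem hj]
        exact ih hLM
      · have hjM : j ∈ M := hL (Finset.mem_insert_self j _)
        -- The marginal of `j` is smallest over `M.erase j`, where `hmono` makes it nonnegative.
        have h₁ := step' j hjM (A ∪ T) (M.erase j) (Finset.subset_erase.2 ⟨hLM, hj⟩)
          (Finset.erase_subset j M) (Finset.notMem_erase j M)
        rw [Finset.insert_erase hjM] at h₁
        linarith [hmono j hjM, ih hLM]
  have mono' : ∀ A B : Finset α, A ⊆ B → B ⊆ M → f A ≤ f B := by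
    intro A B hAB hB
    simpa [Finset.union_eq_right.2 hAB] using mono A B (by rwa [Finset.union_eq_right.2 hAB])
  refine ⟨h₀, fun A hA => h₀ ▸ mono' ∅ A (Finset.empty_subset A) hA, mono', fun A B hA hB => ?_⟩
  -- Adding the elements of `A \ B` one at a time raises the rank over `B` by no more than over `A ∩
  -- B`.
  have key : ∀ T : Finset α, T ⊆ M → Disjoint T B →
      f (B ∪ T) + f (A ∩ B) ≤ f (A ∩ B ∪ T) + f B := by
    intro T
    induction T using Finset.induction_on with
    | empty => intros; simp [add_comm]
    | insert i T hi ih =>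
      intro hT hd
      rw [Finset.insert_subset_iff] at hT
      rw [Finset.disjoint_insert_left] at hd
      have h₁ := step' i hT.1 (A ∩ B ∪ T) (B ∪ T)
        (Finset.union_subset_union_left Finset.inter_subset_right)
        (Finset.union_subset hB hT.2) (by simp [hd.1, hi])
      rw [Finset.union_insert, Finset.union_insert]
      linarith [ih hT.2 hd.2]
  have h := key (A \ B) (Finset.sdiff_subset.trans hA) Finset.sdiff_disjoint
  rwa [Finset.union_sdiff_self_eq_union, Finset.union_comm B A, Finset.union_comm (A ∩ B),
    Finset.sdiff_union_inter] at h

/-- The subset of `M` whose membership bits at `a, b, p, q` and at the other elements are given. -/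
def bitSet (M : Finset α) (a b p q : α) (i j k l m : Bool) : Finset α :=
  M.filter fun z => (if z = a then i else if z = b then j else if z = p then k
    else if z = q then l else m) = true

theorem bitSet_union (M : Finset α) (a b p q : α) (i j k l m i' j' k' l' m' : Bool) :
    bitSet M a b p q i j k l m ∪ bitSet M a b p q i' j' k' l' m' =
      bitSet M a b p q (i || i') (j || j') (k || k') (l || l') (m || m') := by
  rw [bitSet, bitSet, bitSet, ← Finset.filter_or]
  refine Finset.filter_congr fun z _ => ?_
  split_ifs <;> simp

theorem bitSet_inter (M : Finset α) (a b p q : α) (i j k l m i' j' k' l' m' : Bool) :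
    bitSet M a b p q i j k l m ∩ bitSet M a b p q i' j' k' l' m' =
      bitSet M a b p q (i && i') (j && j') (k && k') (l && l') (m && m') := by
  rw [bitSet, bitSet, bitSet, ← Finset.filter_and]
  refine Finset.filter_congr fun z _ => ?_
  split_ifs <;> simp

theorem bitSet_mem {M A : Finset α} {a b p q y : α} (hM : M ⊆ {a, b, p, q, y}) (hA : A ⊆ M) :
    bitSet M a b p q (a ∈ A) (b ∈ A) (p ∈ A) (q ∈ A) (y ∈ A) = A := by
  ext z
  simp only [bitSet, Finset.mem_filter]
  constructor
  · rintro ⟨hz, h⟩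
    have := hM hz
    simp only [Finset.mem_insert, Finset.mem_singleton] at this
    grind
  · intro h
    have hz := hA h
    have := hM hz
    simp only [Finset.mem_insert, Finset.mem_singleton] at this
    grind

/-- The function on subsets of `{a, b, p, q, y}` with rank `f` without `y` and `g` with `y`. -/
def ofBits (a b p q y : α) (f g : Bool → Bool → Bool → Bool → ℝ) (A : Finset α) : ℝ :=
  if y ∈ A then g (a ∈ A) (b ∈ A) (p ∈ A) (q ∈ A) else f (a ∈ A) (b ∈ A) (p ∈ A) (q ∈ A)

/-- Bits of elements outside `M` have no effect, so such elements act as loops. This puts the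
polymatroids on abpq and on aby into the same five-element form. -/
theorem IsPolymatroid.exists_elemExt {h : Finset α → ℝ} {M : Finset α} (hh : IsPolymatroid h M)
    {a b p q y : α} (hM : M ⊆ {a, b, p, q, y}) :
    ∃ f g, ElemExt f g ∧ f 𝟬 𝟬 𝟬 𝟬 = 0 ∧ ∀ A ⊆ M, h A = ofBits a b p q y f g A := by
  have hsub : ∀ i j k l m, bitSet M a b p q i j k l m ⊆ M := fun _ _ _ _ _ =>
    Finset.filter_subset _ _
  have sub : ∀ i j k l m i' j' k' l' m', _ := fun i j k l m i' j' k' l' m' =>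
    hh.submodular _ _ (hsub i j k l m) (hsub i' j' k' l' m')
  have mono : ∀ i j k l m i' j' k' l' m', _ := fun i j k l m i' j' k' l' m' =>
    hh.mono (bitSet M a b p q i j k l m) _ Finset.subset_union_left
      (bitSet_union M a b p q i j k l m i' j' k' l' m' ▸ hsub _ _ _ _ _)
  simp only [bitSet_union, bitSet_inter] at sub mono
  have elem : ∀ m, ElemIneq fun i j k l => h (bitSet M a b p q i j k l m) := fun m =>
    { ma := by simpa using mono 𝟬 𝟭 𝟭 𝟭 m 𝟭 𝟭 𝟭 𝟭 m
      mb := by simpa using mono 𝟭 𝟬 𝟭 𝟭 m 𝟭 𝟭 𝟭 𝟭 m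
      mp := by simpa using mono 𝟭 𝟭 𝟬 𝟭 m 𝟭 𝟭 𝟭 𝟭 m
      mq := by simpa using mono 𝟭 𝟭 𝟭 𝟬 m 𝟭 𝟭 𝟭 𝟭 m
      sab := fun k l => by simpa using sub 𝟭 𝟬 k l m 𝟬 𝟭 k l m
      sap := fun j l => by simpa using sub 𝟭 j 𝟬 l m 𝟬 j 𝟭 l m
      saq := fun j k => by simpa using sub 𝟭 j k 𝟬 m 𝟬 j k 𝟭 m
      sbp := fun i l => by simpa using sub i 𝟭 𝟬 l m i 𝟬 𝟭 l m
      sbq := fun i k => by simpa using sub i 𝟭 k 𝟬 m i 𝟬 k 𝟭 m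
      spq := fun i j => by simpa using sub i j 𝟭 𝟬 m i j 𝟬 𝟭 m }
  refine ⟨_, _, ⟨elem 𝟬, elem 𝟭, ?_, fun j k l => ?_, fun i k l => ?_, fun i j l => ?_,
    fun i j k => ?_⟩, ?_, fun A hA => ?_⟩
  · simpa using mono 𝟭 𝟭 𝟭 𝟭 𝟬 𝟭 𝟭 𝟭 𝟭 𝟭
  · simpa using sub 𝟭 j k l 𝟬 𝟬 j k l 𝟭
  · simpa using sub i 𝟭 k l 𝟬 i 𝟬 k l 𝟭
  · simpa using sub i j 𝟭 l 𝟬 i j 𝟬 l 𝟭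
  · simpa using sub i j k 𝟭 𝟬 i j k 𝟬 𝟭
  · simpa [bitSet] using hh.empty
  · conv_lhs => rw [← bitSet_mem hM hA]
    by_cases hy : y ∈ A <;> simp [ofBits, hy]

theorem ElemExt.isPolymatroid {f g : Bool → Bool → Bool → Bool → ℝ} (h : ElemExt f g)
    (f₀ : f 𝟬 𝟬 𝟬 𝟬 = 0) {a b p q y : α} (hd : [a, b, p, q, y].Nodup) :
    IsPolymatroid (ofBits a b p q y f g) {a, b, p, q, y} := by
  have hne := hd
  simp only [List.nodup_cons, List.mem_cons, List.not_mem_nil, or_false, not_or] at hne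
  obtain ⟨⟨hab, hap, haq, hay⟩, ⟨hbp, hbq, hby⟩, ⟨hpq, hpy⟩, hqy, -⟩ := hne
  let R : α → α → Prop := fun i j => ∀ K : Finset α, i ∉ K → j ∉ K →
    ofBits a b p q y f g (insert i (insert j K)) + ofBits a b p q y f g K ≤
      ofBits a b p q y f g (insert i K) + ofBits a b p q y f g (insert j K)
  -- By symmetry the ten unordered pairs suffice.
  have : Std.Symm R := ⟨fun i j hR K hj hi => by
    rw [Finset.insert_comm, add_comm (ofBits a b p q y f g (insert j K))]
    exact hR K hi hj⟩
  have hpair : [a, b, p, q, y].Pairwise R := by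
    simp only [R, List.pairwise_cons, List.mem_cons, List.not_mem_nil, or_false, forall_eq_or_imp,
      forall_eq, List.Pairwise.nil, and_true, false_imp_iff, implies_true]
    refine ⟨⟨?_, ?_, ?_, ?_⟩, ⟨?_, ?_, ?_⟩, ⟨?_, ?_⟩, ?_⟩ <;> intro K hi hj <;>
      by_cases hyK : y ∈ K <;>
      simp_all [ofBits, Ne.symm hab, Ne.symm hap, Ne.symm haq, Ne.symm hay, Ne.symm hbp, Ne.symm
        hbq, Ne.symm hby, Ne.symm hpq, Ne.symm hpy, Ne.symm hqy, h.left.sab, h.left.sap,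
        h.left.saq, h.left.sbp, h.left.sbq, h.left.spq, h.right.sab, h.right.sap, h.right.saq,
        h.right.sbp, h.right.sbq, h.right.spq, h.anti_a, h.anti_b, h.anti_p, h.anti_q]
  refine IsPolymatroid.of_elemental ?_ ?_ fun i hi j hj hij K _ => ?_
  · simp [ofBits, f₀]
  · simp [ofBits, hab, hap, haq, hay, hbp, hbq, hby, hpq, hpy, hqy, Ne.symm hab, Ne.symm hap,
      Ne.symm haq, Ne.symm hay, Ne.symm hbp, Ne.symm hbq, Ne.symm hby, Ne.symm hpq, Ne.symm hpy,
      Ne.symm hqy, h.right.ma, h.right.mb, h.right.mp, h.right.mq, h.top]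
  · exact hpair.forall (by simpa using hi) (by simpa using hj) hij K

/-! ### The stated inequalities as bounds, and the amalgam -/

theorem ingletonBounds_iff {a b p q y : α} (hd : [a, b, p, q, y].Nodup) {fX fy : Finset α → ℝ}
    {f g f' g' : Bool → Bool → Bool → Bool → ℝ}
    (hX : ∀ A ⊆ {a, b, p, q}, fX A = ofBits a b p q y f g A)
    (hy : ∀ A ⊆ {a, b, y}, fy A = ofBits a b p q y f' g' A) (f₀ : f 𝟬 𝟬 𝟬 𝟬 = 0)
    (hab : ∀ i j, f i j 𝟬 𝟬 = f' i j 𝟬 𝟬) :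
    (∀ a' b' p' q' : α, (a' = a ∧ b' = b ∨ a' = b ∧ b' = a) →
      (p' = p ∧ q' = q ∨ p' = q ∧ q' = p) →
        0 ≤ ingleton fX {a'} {b'} {p'} {q'} + condMutualInfo fy {y} {a'} {b'}
          + condMutualInfo fy {y} {b'} {a'} + condMutualInfo fy {a'} {b'} {y}
          + 3 * condRank fy {y} {a', b'} ∧
        0 ≤ ingleton fX {a'} {p'} {b'} {q'} + condMutualInfo fy {y} {a'} {b'}
          + condMutualInfo fy {y} {b'} {a'} + condMutualInfo fy {a'} {b'} {y}
          + 3 * condRank fy {y} {a', b'}) ↔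
      IngletonBounds f (g' 𝟬 𝟬 𝟬 𝟬) (g' 𝟭 𝟬 𝟬 𝟬) (g' 𝟬 𝟭 𝟬 𝟬) := by
  simp only [List.nodup_cons, List.mem_cons, List.not_mem_nil, or_false, not_or] at hd
  obtain ⟨⟨nab, nap, naq, nay⟩, ⟨nbp, nbq, nby⟩, ⟨npq, npy⟩, nqy, -⟩ := hd
  rw [forall_swap_iff]
  simp [ingleton, mutualInfo, condMutualInfo, condRank, hX, hy, Finset.insert_subset_iff, ofBits,
    nab, nap, naq, nay, nbp, nbq, nby, npq, npy, nqy, Ne.symm nab, Ne.symm nap, Ne.symm naq,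
    Ne.symm nay, Ne.symm nbp, Ne.symm nbq, Ne.symm nby, Ne.symm npq, Ne.symm npy, Ne.symm nqy,
    f₀, ← hab, -neg_add_rev, -neg_sub]
  constructor
  -- The discarded components are the three repetitions of the invariant first inequality.
  · rintro ⟨⟨⟨h₁, h₂⟩, -, h₃⟩, ⟨-, h₄⟩, -, h₅⟩
    constructor <;> linarith only [h₁, h₂, h₃, h₄, h₅]
  · rintro ⟨h₁, h₂, h₃, h₄, h₅⟩
    refine ⟨⟨⟨?_, ?_⟩, ?_, ?_⟩, ⟨?_, ?_⟩, ?_, ?_⟩ <;> linarith only [h₁, h₂, h₃, h₄, h₅]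

end Polymatroid

open Polymatroid in
theorem mainTheorem6 {α : Type*} [DecidableEq α] (a b x₁ x₂ y : α)
    (hdistinct : [a, b, x₁, x₂, y].Nodup)
    (fX fy : Finset α → ℝ)
    (hX : Polymatroid.IsPolymatroid fX {a, b, x₁, x₂})
    (hy : Polymatroid.IsPolymatroid fy {a, b, y})
    (hab : Polymatroid.AgreeOn fX fy {a, b}) :
    Polymatroid.HaveAmalgam fX {a, b, x₁, x₂} fy {a, b, y} ↔
      ∀ a' b' x₁' x₂' : α,
        (a' = a ∧ b' = b ∨ a' = b ∧ b' = a) →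
        (x₁' = x₁ ∧ x₂' = x₂ ∨ x₁' = x₂ ∧ x₂' = x₁) →
        0 ≤ Polymatroid.ingleton fX {a'} {b'} {x₁'} {x₂'}
            + Polymatroid.condMutualInfo fy {y} {a'} {b'} + Polymatroid.condMutualInfo fy {y} {b'} {a'}
            + Polymatroid.condMutualInfo fy {a'} {b'} {y} + 3 * Polymatroid.condRank fy {y} {a', b'} ∧
        0 ≤ Polymatroid.ingleton fX {a'} {x₁'} {b'} {x₂'}
            + Polymatroid.condMutualInfo fy {y} {a'} {b'} + Polymatroid.condMutualInfo fy {y} {b'} {a'}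
            + Polymatroid.condMutualInfo fy {a'} {b'} {y} + 3 * Polymatroid.condRank fy {y} {a', b'} := by
  have hunion : ({a, b, x₁, x₂} ∪ {a, b, y} : Finset α) = {a, b, x₁, x₂, y} := by
    ext z
    simp
  constructor
  · rintro ⟨h, hh, hhX, hhy⟩
    obtain ⟨f, g, hfg, f₀, hfgh⟩ := hh.exists_elemExt (y := y) hunion.subset
    exact (ingletonBounds_iff hdistinct
      (fun A hA => (hhX A hA).symm.trans (hfgh A (hA.trans Finset.subset_union_left)))
      (fun A hA => (hhy A hA).symm.trans (hfgh A (hA.trans Finset.subset_union_right)))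
      f₀ fun _ _ => rfl).2 hfg.ingletonBounds
  · intro H
    obtain ⟨f, g, hfg, f₀, hfgX⟩ := hX.exists_elemExt (q := x₂) (y := y)
      (hunion ▸ Finset.subset_union_left)
    obtain ⟨f', g', hfg', f₀', hfgy⟩ := hy.exists_elemExt (p := x₁) (q := x₂)
      (hunion ▸ Finset.subset_union_right)
    have hne := hdistinct
    simp only [List.nodup_cons, List.mem_cons, List.not_mem_nil, or_false, not_or] at hne
    obtain ⟨⟨nab, nap, naq, nay⟩, ⟨nbp, nbq, nby⟩, ⟨npq, npy⟩, nqy, -⟩ := hne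
    have agree : ∀ A ⊆ {a, b}, ofBits a b x₁ x₂ y f g A = ofBits a b x₁ x₂ y f' g' A :=
      fun A hA => by
        rw [← hfgX A (hA.trans (by grind)), ← hfgy A (hA.trans (by grind)), hab A hA]
    have ha := agree {a} (by simp)
    have hb := agree {b} (by simp)
    have hab' := agree {a, b} subset_rfl
    simp [ofBits, nab, Ne.symm nab, Ne.symm nap, Ne.symm naq, Ne.symm nay, Ne.symm nbp,
      Ne.symm nbq, Ne.symm nby] at ha hb hab'
    have hff' : ∀ i j, f i j false false = f' i j false false := by
      rintro (_ | _) (_ | _)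
      exacts [f₀.trans f₀'.symm, hb, ha, hab']
    obtain ⟨g₁, hg₁, hgg'⟩ := Polymatroid.exists_elemExt hfg.left f₀ hfg' f₀' ha hb hab'
      ((ingletonBounds_iff hdistinct hfgX hfgy f₀ hff').1 H)
    -- The amalgam keeps `f` on sets without y and takes the constructed `g₁` on sets with y; `hff'`
    -- and `hgg'` make it agree with `fy`.
    refine ⟨ofBits a b x₁ x₂ y f g₁, hunion ▸ hg₁.isPolymatroid f₀ hdistinct, fun A hA => ?_,
      fun A hA => ?_⟩
    · have hyA : y ∉ A := fun h => by
        have := hA h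
        grind
      simp [hfgX A hA, ofBits, hyA]
    · have hpA : x₁ ∉ A := fun h => by
        have := hA h
        grind
      have hqA : x₂ ∉ A := fun h => by
        have := hA h
        grind
      simp [hfgy A hA, ofBits, hpA, hqA, hff', hgg']
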